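/- Let $(\xi_i)_{i\ge 3}$ be the Cramér model, i.e. independent random variables with $$\mathbb P\{\xi_i=1\}=\frac1{\log i},\qquad \mathbb P\{\xi_i=0\}=1-\frac1{\log i}\qquad(i\ge 3),$$ and for $n\ge 3$ put $S_n=\sum_{j=3}^n\xi_j$, $m_n=\mathbb E\,S_n=\sum_{j=3}^n\frac1{\log j}$ and $B_n=\mathrm{Var}(S_n)=\sum_{j=3}^n\frac1{\log j}\bigl(1-\frac1{\log j}\bigr)$. There is an absolute constant $C_0>0$ such that for every constant $C\ge C_0$, every integer $n\ge 3$ and every $\kappa\in\mathbb Z$ with $$|\kappa-m_n|\le C\,\frac{n^{3/4}}{\log n},$$ we have $$\left|\,\mathbb P\{S_n=\kappa\}-\frac{e^{-\frac{(\kappa-m_n)^2}{2B_n}}}{\sqrt{2\pi B_n}}\,\right|\le C\,\frac{(\log n)^{3/2}}{n}.$$ -/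

import Mathlib

open MeasureTheory ProbabilityTheory

/-- The Cramér model: under `μ`, the random variables `ξ i`, `i ≥ 3`, are independent, and `ξ i`
takes the value `1` with probability `1 / log i` and the value `0` with probability
`1 - 1 / log i`. The variables `ξ 0`, `ξ 1`, `ξ 2` are not part of the model and are not
constrained. -/
structure IsCramerModel {Ω : Type*} [MeasurableSpace Ω] (μ : Measure Ω) (ξ : ℕ → Ω → ℝ) :
    Prop where
  measurable : ∀ i : ℕ, 3 ≤ i → Measurable (ξ i)
  indep : iIndepFun (fun i : {i : ℕ // 3 ≤ i} => ξ i) μ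
  prob_one : ∀ i : ℕ, 3 ≤ i → μ.real {ω | ξ i ω = 1} = 1 / Real.log i
  prob_zero : ∀ i : ℕ, 3 ≤ i → μ.real {ω | ξ i ω = 0} = 1 - 1 / Real.log i

/-- The partial sum `S n = ξ 3 + ⋯ + ξ n`. -/
noncomputable def cramerSum {Ω : Type*} (ξ : ℕ → Ω → ℝ) (n : ℕ) : Ω → ℝ :=
  fun ω => ∑ j ∈ Finset.Icc 3 n, ξ j ω

/-- The mean `m n = E (S n)`. -/
noncomputable def cramerMean {Ω : Type*} [MeasurableSpace Ω] (μ : Measure Ω) (ξ : ℕ → Ω → ℝ)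
    (n : ℕ) : ℝ :=
  ∫ ω, cramerSum ξ n ω ∂μ

/-- The variance `B n = Var (S n)`. -/
noncomputable def cramerVar {Ω : Type*} [MeasurableSpace Ω] (μ : Measure Ω) (ξ : ℕ → Ω → ℝ)
    (n : ℕ) : ℝ :=
  variance (cramerSum ξ n) μ

/-- The characteristic function at `t` of a centred Bernoulli variable of parameter `p`. -/
noncomputable def centredBernoulliCharFun (p t : ℝ) : ℂ :=
  Complex.exp ((-(p * t) : ℝ) * Complex.I) * ((1 - p : ℝ) + (p : ℝ) * Complex.exp (t * Complex.I))

theorem norm_centredBernoulliCharFun_le {p t : ℝ} (hp0 : 0 ≤ p) (hp1 : p ≤ 1)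
    (ht : |t| ≤ Real.pi) :
    ‖centredBernoulliCharFun p t‖ ≤ Real.exp (-(2 / Real.pi ^ 2 * t ^ 2) * (p * (1 - p))) := by
  rw [centredBernoulliCharFun, norm_mul, Complex.norm_exp_ofReal_mul_I, one_mul]
  have hv : 0 ≤ p * (1 - p) := mul_nonneg hp0 (by linarith)
  have hcos := Real.cos_le_one_sub_mul_cos_sq ht
  -- The squared modulus is exactly $1-2p(1-p)(1-\cos t)$; then $1-u\le e^{-u}$ and the quadratic
  -- bound on cosine apply.
  refine le_of_sq_le_sq ?_ (Real.exp_pos _).le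
  rw [← Real.exp_nat_mul, Complex.sq_norm]
  have h1 : Complex.normSq ((1 - p : ℝ) + (p : ℝ) * Complex.exp (t * Complex.I))
      = 1 - 2 * (p * (1 - p)) * (1 - Real.cos t) := by
    rw [Complex.exp_mul_I, ← Complex.ofReal_cos, ← Complex.ofReal_sin, Complex.normSq_apply]
    simp [-Complex.ofReal_cos, -Complex.ofReal_sin]
    linear_combination p ^ 2 * Real.sin_sq_add_cos_sq t
  rw [h1]
  refine le_trans ?_ (Real.add_one_le_exp _)
  push_cast
  nlinarith [mul_le_mul_of_nonneg_left hcos hv]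

/-- The centred Bernoulli and the Gaussian of equal variance share their first two moments, so the
error is cubic. Keeping the factor $p(1-p)$ makes the errors sum to the total variance. -/
theorem norm_centredBernoulliCharFun_sub_exp_le {p t : ℝ} (hp0 : 0 ≤ p) (hp1 : p ≤ 1)
    (ht : |t| ≤ Real.pi) :
    ‖centredBernoulliCharFun p t - (Real.exp (-(p * (1 - p) * t ^ 2 / 2)) : ℝ)‖
      ≤ 2 * Real.exp 4 * (p * (1 - p)) * |t| ^ 3 := by
  have hpi : Real.pi ≤ 4 := Real.pi_le_four
  have ht4 : |t| ≤ 4 := ht.trans hpi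
  have hq0 : 0 ≤ 1 - p := by linarith
  have hv : 0 ≤ p * (1 - p) := mul_nonneg hp0 hq0
  have hv4 : p * (1 - p) ≤ 1 / 4 := by nlinarith [sq_nonneg (p - 1 / 2)]
  have habs := abs_nonneg t
  -- third order Taylor bound for `exp (i x)`
  have taylor3 : ∀ x : ℝ, |x| ≤ 4 →
      ‖Complex.exp (x * Complex.I) - (1 + x * Complex.I - x ^ 2 / 2)‖ ≤ |x| ^ 3 * Real.exp 4 := by
    intro x hx
    have h := Complex.norm_exp_sub_sum_le_norm_mul_exp (x * Complex.I) 3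
    have hn : ‖(x : ℂ) * Complex.I‖ = |x| := by simp
    rw [hn] at h
    have hs : ∑ m ∈ Finset.range 3, ((x : ℂ) * Complex.I) ^ m / (m.factorial : ℂ)
        = 1 + x * Complex.I - x ^ 2 / 2 := by
      simp [Finset.sum_range_succ, mul_pow]
      ring
    rw [hs] at h
    refine h.trans ?_
    gcongr
  have taylor2 : ∀ y : ℝ, 0 ≤ y → y ≤ 4 →
      ‖(Real.exp (-y) : ℂ) - (1 - y)‖ ≤ y ^ 2 * Real.exp 4 := by
    intro y hy0 hy
    have h := Complex.norm_exp_sub_sum_le_norm_mul_exp (-y : ℂ) 2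
    have hn : ‖(-y : ℂ)‖ = y := by simp [abs_of_nonneg hy0]
    rw [hn] at h
    have hs : ∑ m ∈ Finset.range 2, (-y : ℂ) ^ m / (m.factorial : ℂ) = 1 - y := by
      simp [Finset.sum_range_succ]
      ring
    rw [hs] at h
    push_cast
    refine h.trans ?_
    gcongr
  have e1 : |-(p * t)| = p * |t| := by rw [abs_neg, abs_mul, abs_of_nonneg hp0]
  have e2 : |(1 - p) * t| = (1 - p) * |t| := by rw [abs_mul, abs_of_nonneg hq0]
  have a1 := taylor3 (-(p * t)) (by rw [e1]; nlinarith)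
  have a2 := taylor3 ((1 - p) * t) (by rw [e2]; nlinarith)
  have hy0 : 0 ≤ p * (1 - p) * t ^ 2 / 2 := by positivity
  have ht2 : t ^ 2 = |t| ^ 2 := (sq_abs t).symm
  have a3 := taylor2 (p * (1 - p) * t ^ 2 / 2) hy0 (by rw [ht2]; nlinarith)
  rw [e1] at a1
  rw [e2] at a2
  set T1 : ℂ := Complex.exp ((-(p * t) : ℝ) * Complex.I)
    - (1 + (-(p * t) : ℝ) * Complex.I - ((-(p * t) : ℝ) : ℂ) ^ 2 / 2) with hT1
  set T2 : ℂ := Complex.exp (((1 - p) * t : ℝ) * Complex.I)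
    - (1 + ((1 - p) * t : ℝ) * Complex.I - (((1 - p) * t : ℝ) : ℂ) ^ 2 / 2) with hT2
  set T3 : ℂ := (Real.exp (-(p * (1 - p) * t ^ 2 / 2)) : ℂ)
    - (1 - (p * (1 - p) * t ^ 2 / 2 : ℝ)) with hT3
  -- The quadratic Taylor polynomials combine to $1-p(1-p)t^2/2$, which cancels the linear part of
  -- the Gaussian; only remainders survive.
  have key : centredBernoulliCharFun p t - (Real.exp (-(p * (1 - p) * t ^ 2 / 2)) : ℝ)
      = ((1 - p : ℝ) : ℂ) * T1 + (p : ℂ) * T2 - T3 := by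
    have hexp : Complex.exp (((1 - p) * t : ℝ) * Complex.I)
        = Complex.exp ((-(p * t) : ℝ) * Complex.I) * Complex.exp (t * Complex.I) := by
      rw [← Complex.exp_add]
      congr 1
      push_cast
      ring
    rw [hT1, hT2, hT3, hexp, centredBernoulliCharFun]
    push_cast
    ring
  rw [key]
  have hE : 0 < Real.exp 4 := Real.exp_pos 4
  have b1 : ‖((1 - p : ℝ) : ℂ) * T1‖ ≤ (1 - p) * ((p * |t|) ^ 3 * Real.exp 4) := by
    rw [norm_mul, Complex.norm_real, Real.norm_of_nonneg hq0]
    gcongr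
  have b2 : ‖(p : ℂ) * T2‖ ≤ p * (((1 - p) * |t|) ^ 3 * Real.exp 4) := by
    rw [norm_mul, Complex.norm_real, Real.norm_of_nonneg hp0]
    gcongr
  have c1 : (1 - p) * (p * |t|) ^ 3 + p * ((1 - p) * |t|) ^ 3 ≤ p * (1 - p) * |t| ^ 3 := by
    have : (1 - p) * (p * |t|) ^ 3 + p * ((1 - p) * |t|) ^ 3
        = p * (1 - p) * |t| ^ 3 * (1 - 2 * (p * (1 - p))) := by ring
    rw [this]
    exact mul_le_of_le_one_right (by positivity) (by linarith)
  have c2 : (p * (1 - p) * t ^ 2 / 2) ^ 2 ≤ p * (1 - p) * |t| ^ 3 := by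
    have : (p * (1 - p) * t ^ 2 / 2) ^ 2
        = p * (1 - p) * |t| ^ 3 * (p * (1 - p) * |t| / 4) := by rw [ht2]; ring
    rw [this]
    exact mul_le_of_le_one_right (by positivity) (by nlinarith)
  calc ‖((1 - p : ℝ) : ℂ) * T1 + (p : ℂ) * T2 - T3‖
      ≤ ‖((1 - p : ℝ) : ℂ) * T1‖ + ‖(p : ℂ) * T2‖ + ‖T3‖ :=
        (norm_sub_le _ _).trans (add_le_add_left (norm_add_le _ _) _)
    _ ≤ ((1 - p) * (p * |t|) ^ 3 + p * ((1 - p) * |t|) ^ 3) * Real.exp 4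
        + (p * (1 - p) * t ^ 2 / 2) ^ 2 * Real.exp 4 := by linarith
    _ ≤ 2 * Real.exp 4 * (p * (1 - p)) * |t| ^ 3 := by
        nlinarith [mul_le_mul_of_nonneg_right c1 hE.le, mul_le_mul_of_nonneg_right c2 hE.le]

/-- Factors are exchanged one at a time. Measuring each error relative to `r i` keeps the full
product of the `r i`, hence the full Gaussian decay. -/
theorem norm_prod_sub_prod_le {ι : Type*} (s : Finset ι) (a b : ι → ℂ) (r w : ι → ℝ)
    (ha : ∀ i ∈ s, ‖a i‖ ≤ r i) (hb : ∀ i ∈ s, ‖b i‖ ≤ r i)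
    (hab : ∀ i ∈ s, ‖a i - b i‖ ≤ w i * r i) :
    ‖∏ i ∈ s, a i - ∏ i ∈ s, b i‖ ≤ (∑ i ∈ s, w i) * ∏ i ∈ s, r i := by
  classical
  induction s using Finset.induction_on with
  | empty => simp
  | insert j s hj ih =>
    have ih := ih (fun i hi => ha i (Finset.mem_insert_of_mem hi))
      (fun i hi => hb i (Finset.mem_insert_of_mem hi))
      (fun i hi => hab i (Finset.mem_insert_of_mem hi))
    have hj' := Finset.mem_insert_self j s
    rw [Finset.prod_insert hj, Finset.prod_insert hj, Finset.prod_insert hj, Finset.sum_insert hj]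
    have hprod : ‖∏ i ∈ s, b i‖ ≤ ∏ i ∈ s, r i := by
      rw [norm_prod]
      exact Finset.prod_le_prod (fun _ _ => norm_nonneg _)
        (fun i hi => hb i (Finset.mem_insert_of_mem hi))
    have hr : 0 ≤ r j := (norm_nonneg _).trans (ha j hj')
    have hwr : 0 ≤ w j * r j := (norm_nonneg _).trans (hab j hj')
    calc ‖a j * ∏ i ∈ s, a i - b j * ∏ i ∈ s, b i‖
        = ‖a j * (∏ i ∈ s, a i - ∏ i ∈ s, b i) + (a j - b j) * ∏ i ∈ s, b i‖ := by
          congr 1; ring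
      _ ≤ ‖a j‖ * ‖∏ i ∈ s, a i - ∏ i ∈ s, b i‖ + ‖a j - b j‖ * ‖∏ i ∈ s, b i‖ := by
          rw [← norm_mul, ← norm_mul]; exact norm_add_le _ _
      _ ≤ r j * ((∑ i ∈ s, w i) * ∏ i ∈ s, r i) + w j * r j * ∏ i ∈ s, r i :=
          add_le_add (mul_le_mul (ha j hj') ih (norm_nonneg _) hr)
            (mul_le_mul (hab j hj') hprod (norm_nonneg _) hwr)
      _ = (w j + ∑ i ∈ s, w i) * (r j * ∏ i ∈ s, r i) := by ring

theorem norm_prod_centredBernoulliCharFun_sub_exp_le {ι : Type*} (s : Finset ι) (p : ι → ℝ)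
    (hp0 : ∀ i ∈ s, 0 ≤ p i) (hp1 : ∀ i ∈ s, p i ≤ 1) {t : ℝ} (ht : |t| ≤ Real.pi) :
    ‖∏ i ∈ s, centredBernoulliCharFun (p i) t
        - (Real.exp (-((∑ i ∈ s, p i * (1 - p i)) * t ^ 2 / 2)) : ℝ)‖
      ≤ 2 * Real.exp 5 * (∑ i ∈ s, p i * (1 - p i)) * |t| ^ 3
        * Real.exp (-(2 / Real.pi ^ 2 * t ^ 2) * ∑ i ∈ s, p i * (1 - p i)) := by
  have hpi := Real.pi_pos
  have hpi3 := Real.pi_gt_three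
  have hsq : t ^ 2 ≤ Real.pi ^ 2 := sq_le_sq' (abs_le.mp ht).1 (abs_le.mp ht).2
  have hc : 2 / Real.pi ^ 2 * t ^ 2 ≤ 2 := by
    rw [div_mul_eq_mul_div, div_le_iff₀ (by positivity)]
    linarith
  have hv : ∀ i ∈ s, 0 ≤ p i * (1 - p i) := fun i hi =>
    mul_nonneg (hp0 i hi) (by linarith [hp1 i hi])
  have h := norm_prod_sub_prod_le s (fun i => centredBernoulliCharFun (p i) t)
    (fun i => ((Real.exp (-(p i * (1 - p i) * t ^ 2 / 2)) : ℝ) : ℂ))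
    (fun i => Real.exp (-(2 / Real.pi ^ 2 * t ^ 2) * (p i * (1 - p i))))
    (fun i => 2 * Real.exp 5 * (p i * (1 - p i)) * |t| ^ 3)
    (fun i hi => norm_centredBernoulliCharFun_le (hp0 i hi) (hp1 i hi) ht) ?_ ?_
  · rw [← Complex.ofReal_prod, ← Real.exp_sum, ← Real.exp_sum, ← Finset.mul_sum,
      ← Finset.sum_mul, ← Finset.mul_sum] at h
    convert h using 5
    rw [Finset.sum_mul, Finset.sum_div, Finset.sum_neg_distrib]
  · intro i hi
    rw [Complex.norm_real, Real.norm_of_nonneg (Real.exp_pos _).le, Real.exp_le_exp]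
    have : 2 / Real.pi ^ 2 ≤ 1 / 2 := by
      rw [div_le_iff₀ (by positivity)]; nlinarith
    nlinarith [mul_le_mul_of_nonneg_right this (mul_nonneg (hv i hi) (sq_nonneg t))]
  · intro i hi
    refine (norm_centredBernoulliCharFun_sub_exp_le (hp0 i hi) (hp1 i hi) ht).trans ?_
    have h4 : p i * (1 - p i) ≤ 1 / 4 := by nlinarith [sq_nonneg (p i - 1 / 2)]
    have h0 : 0 ≤ 2 / Real.pi ^ 2 * t ^ 2 := by positivity
    -- The cubic bound lacks the decay factor `r i`; as its exponent is at least $-1/2$, raising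
    -- $e^4$ to $e^5$ pays for inserting it.
    have : Real.exp 4 ≤ Real.exp 5 * Real.exp (-(2 / Real.pi ^ 2 * t ^ 2) * (p i * (1 - p i))) := by
      rw [← Real.exp_add, Real.exp_le_exp]
      nlinarith [hv i hi]
    have hX : 0 ≤ 2 * (p i * (1 - p i)) * |t| ^ 3 :=
      mul_nonneg (mul_nonneg zero_le_two (hv i hi)) (by positivity)
    nlinarith [mul_le_mul_of_nonneg_left this hX]

/-! ### Gaussian moments and the Fourier form of the Gaussian density. -/

theorem integrable_abs_pow_mul_exp_neg_mul_sq {b : ℝ} (hb : 0 < b) (k : ℕ) :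
    Integrable (fun t : ℝ => |t| ^ k * Real.exp (-b * t ^ 2)) := by
  have h := (integrable_rpow_mul_exp_neg_mul_sq hb
    (s := (k : ℝ)) (by have := k.cast_nonneg (α := ℝ); linarith)).norm
  refine h.congr (ae_of_all _ fun t => ?_)
  simp [Real.rpow_natCast]

theorem integral_abs_pow_mul_exp_neg_mul_sq {b : ℝ} (hb : 0 < b) (k : ℕ) :
    ∫ t : ℝ, |t| ^ k * Real.exp (-b * t ^ 2)
      = b ^ (-((k : ℝ) + 1) / 2) * Real.Gamma (((k : ℝ) + 1) / 2) := by
  have h := integral_rpow_mul_exp_neg_mul_rpow (p := 2) (q := k) (b := b) two_pos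
    (by have := k.cast_nonneg (α := ℝ); linarith) hb
  have h2 := integral_comp_abs (f := fun t : ℝ => t ^ k * Real.exp (-b * t ^ 2))
  simp only [sq_abs] at h2
  simp only [Real.rpow_natCast, Real.rpow_two] at h
  rw [h2, h]
  ring

theorem integral_abs_mul_exp_neg_mul_sq {b : ℝ} (hb : 0 < b) :
    ∫ t : ℝ, |t| ^ 1 * Real.exp (-b * t ^ 2) = 1 / b := by
  rw [integral_abs_pow_mul_exp_neg_mul_sq hb]
  norm_num [Real.rpow_neg_one]

theorem integral_abs_cube_mul_exp_neg_mul_sq {b : ℝ} (hb : 0 < b) :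
    ∫ t : ℝ, |t| ^ 3 * Real.exp (-b * t ^ 2) = 1 / b ^ 2 := by
  rw [integral_abs_pow_mul_exp_neg_mul_sq hb]
  norm_num

theorem gaussianDensity_eq_integral {B : ℝ} (hB : 0 < B) (x : ℝ) :
    ((Real.exp (-x ^ 2 / (2 * B)) / Real.sqrt (2 * Real.pi * B) : ℝ) : ℂ)
      = (1 / (2 * Real.pi) : ℝ) * ∫ t : ℝ, Complex.exp ((-(x * t) : ℝ) * Complex.I)
          * (Real.exp (-(B * t ^ 2 / 2)) : ℝ) := by
  have hpi := Real.pi_pos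
  have h := fourierIntegral_gaussian (b := ((B / 2 : ℝ) : ℂ)) (by simpa using hB) (-x : ℝ)
  have e : ∀ t : ℝ, Complex.exp ((-(x * t) : ℝ) * Complex.I)
          * (Real.exp (-(B * t ^ 2 / 2)) : ℝ)
      = Complex.exp (Complex.I * ((-x : ℝ) : ℂ) * t) * Complex.exp (-((B / 2 : ℝ) : ℂ) * t ^ 2) := by
    intro t
    push_cast
    congr 2 <;> ring
  simp_rw [e]
  rw [h]
  have e2 : ((Real.pi : ℂ) / ((B / 2 : ℝ) : ℂ)) ^ (1 / 2 : ℂ)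
      = ((Real.sqrt (2 * Real.pi / B) : ℝ) : ℂ) := by
    rw [Real.sqrt_eq_rpow, Complex.ofReal_cpow (by positivity)]
    push_cast
    congr 1
    have : (B : ℂ) ≠ 0 := by exact_mod_cast hB.ne'
    field_simp
  rw [e2]
  have e3 : Complex.exp (-((-x : ℝ) : ℂ) ^ 2 / (4 * ((B / 2 : ℝ) : ℂ)))
      = ((Real.exp (-x ^ 2 / (2 * B)) : ℝ) : ℂ) := by
    push_cast
    congr 1
    ring
  rw [e3, ← Complex.ofReal_mul, ← Complex.ofReal_mul]
  congr 1
  have e4 : Real.sqrt (2 * Real.pi / B) * Real.sqrt (2 * Real.pi * B) = 2 * Real.pi := by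
    rw [← Real.sqrt_mul (by positivity)]
    have : 2 * Real.pi / B * (2 * Real.pi * B) = (2 * Real.pi) ^ 2 := by field_simp
    rw [this, Real.sqrt_sq (by positivity)]
  have hs : 0 < Real.sqrt (2 * Real.pi * B) := Real.sqrt_pos.mpr (by positivity)
  rw [div_eq_iff hs.ne']
  rw [show ∀ a b c d : ℝ, a * (b * c) * d = c * (a * (b * d)) by intros; ring, e4]
  field_simp

/-! ### Sums of independent Bernoulli variables: lattice inversion and the local limit theorem. -/

section Bernoulli

variable {Ω : Type*} [MeasurableSpace Ω] {μ : Measure Ω} [IsProbabilityMeasure μ]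

theorem ae_eq_zero_or_eq_one_of_bernoulli {X : Ω → ℝ} {p : ℝ} (hX : Measurable X)
    (h1 : μ.real {ω | X ω = 1} = p) (h0 : μ.real {ω | X ω = 0} = 1 - p) :
    ∀ᵐ ω ∂μ, X ω = 0 ∨ X ω = 1 := by
  have hm0 : MeasurableSet {ω | X ω = 0} := hX (measurableSet_singleton 0)
  have hm1 : MeasurableSet {ω | X ω = 1} := hX (measurableSet_singleton 1)
  have hd : Disjoint {ω | X ω = 0} {ω | X ω = 1} := by
    rw [Set.disjoint_left]
    intro ω (h : X ω = 0) (h' : X ω = 1)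
    simp [h] at h'
  have hu : μ.real ({ω | X ω = 0} ∪ {ω | X ω = 1}) = 1 := by
    rw [measureReal_union hd hm1, h0, h1]; ring
  have hu' : μ ({ω | X ω = 0} ∪ {ω | X ω = 1}) = 1 := by
    rw [measureReal_def] at hu
    exact (ENNReal.toReal_eq_one_iff _).mp hu
  exact (mem_ae_iff_prob_eq_one (hm0.union hm1)).mpr hu'

theorem integral_comp_of_bernoulli {E : Type*} [NormedAddCommGroup E] [NormedSpace ℝ E]
    [CompleteSpace E] {X : Ω → ℝ} {p : ℝ} (hX : Measurable X)
    (h1 : μ.real {ω | X ω = 1} = p) (h0 : μ.real {ω | X ω = 0} = 1 - p) (g : ℝ → E) :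
    ∫ ω, g (X ω) ∂μ = (1 - p) • g 0 + p • g 1 := by
  have hm0 : MeasurableSet {ω | X ω = 0} := hX (measurableSet_singleton 0)
  have hm1 : MeasurableSet {ω | X ω = 1} := hX (measurableSet_singleton 1)
  have hae : (fun ω => g (X ω)) =ᵐ[μ] fun ω => Set.indicator {ω | X ω = 0} (fun _ => g 0) ω
      + Set.indicator {ω | X ω = 1} (fun _ => g 1) ω := by
    filter_upwards [ae_eq_zero_or_eq_one_of_bernoulli hX h1 h0] with ω hω
    rcases hω with h | h <;> simp [Set.indicator, h]
  rw [integral_congr_ae hae, integral_add ((integrable_const _).indicator hm0)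
    ((integrable_const _).indicator hm1), integral_indicator_const _ hm0,
    integral_indicator_const _ hm1, h0, h1]

theorem memLp_of_bernoulli {X : Ω → ℝ} {p : ℝ} (hX : Measurable X)
    (h1 : μ.real {ω | X ω = 1} = p) (h0 : μ.real {ω | X ω = 0} = 1 - p) (q : ENNReal) :
    MemLp X q μ := by
  refine MemLp.of_bound hX.aestronglyMeasurable 1 ?_
  filter_upwards [ae_eq_zero_or_eq_one_of_bernoulli hX h1 h0] with ω hω
  rcases hω with h | h <;> simp [h]

theorem integral_of_bernoulli {X : Ω → ℝ} {p : ℝ} (hX : Measurable X)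
    (h1 : μ.real {ω | X ω = 1} = p) (h0 : μ.real {ω | X ω = 0} = 1 - p) :
    ∫ ω, X ω ∂μ = p := by
  simpa using integral_comp_of_bernoulli hX h1 h0 (fun x : ℝ => x)

theorem variance_of_bernoulli {X : Ω → ℝ} {p : ℝ} (hX : Measurable X)
    (h1 : μ.real {ω | X ω = 1} = p) (h0 : μ.real {ω | X ω = 0} = 1 - p) :
    variance X μ = p * (1 - p) := by
  rw [variance_eq_sub (memLp_of_bernoulli hX h1 h0 2), integral_of_bernoulli hX h1 h0]
  have : ∫ ω, (X ^ 2) ω ∂μ = p := by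
    refine (integral_comp_of_bernoulli hX h1 h0 (fun x : ℝ => x ^ 2)).trans ?_
    norm_num
  rw [this]
  ring

theorem integral_exp_int_mul_I (m : ℤ) :
    ∫ t in (-Real.pi)..Real.pi, Complex.exp ((t * (m : ℝ) : ℝ) * Complex.I)
      = if m = 0 then 2 * (Real.pi : ℂ) else 0 := by
  split_ifs with h
  · simp [h]
    ring
  · have hc : (m : ℂ) * Complex.I ≠ 0 := mul_ne_zero (by exact_mod_cast h) Complex.I_ne_zero
    have e : ∀ t : ℝ, Complex.exp ((t * (m : ℝ) : ℝ) * Complex.I)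
        = Complex.exp ((m : ℂ) * Complex.I * t) := by
      intro t
      push_cast
      congr 1
      ring
    simp_rw [e]
    rw [integral_exp_mul_complex hc]
    -- The primitive takes equal values at both endpoints by $2\pi$-periodicity.
    have : Complex.exp ((m : ℂ) * Complex.I * (Real.pi : ℝ))
        = Complex.exp ((m : ℂ) * Complex.I * ((-Real.pi : ℝ) : ℂ)) := by
      rw [← mul_one (Complex.exp ((m : ℂ) * Complex.I * ((-Real.pi : ℝ) : ℂ))),
        ← Complex.exp_int_mul_two_pi_mul_I m, ← Complex.exp_add]
      congr 1
      push_cast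
      ring
    rw [this, sub_self, zero_div]

/-- Fourier inversion for the atoms of an integer-valued random variable. -/
theorem measureReal_eq_int_eq_integral_charFun {S : Ω → ℝ} (hS : Measurable S)
    (hint : ∀ᵐ ω ∂μ, ∃ m : ℤ, S ω = m) (κ : ℤ) :
    ((μ.real {ω | S ω = (κ : ℝ)} : ℝ) : ℂ) = (1 / (2 * Real.pi) : ℝ)
      * ∫ t in (-Real.pi)..Real.pi, ∫ ω, Complex.exp ((t * (S ω - κ) : ℝ) * Complex.I) ∂μ := by
  have hpi := Real.pi_pos
  have hle : -Real.pi ≤ Real.pi := by linarith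
  have hmS : MeasurableSet {ω | S ω = (κ : ℝ)} := hS (measurableSet_singleton _)
  rw [intervalIntegral.integral_of_le hle, integral_integral_swap]
  · have hae : (fun ω => ∫ t in Set.Ioc (-Real.pi) Real.pi,
          Complex.exp ((t * (S ω - κ) : ℝ) * Complex.I))
        =ᵐ[μ] Set.indicator {ω | S ω = (κ : ℝ)} (fun _ => 2 * (Real.pi : ℂ)) := by
      filter_upwards [hint] with ω ⟨m, hm⟩
      have h := integral_exp_int_mul_I (m - κ)
      rw [intervalIntegral.integral_of_le hle] at h
      rw [hm]
      push_cast at h ⊢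
      rw [h, Set.indicator_apply]
      simp [hm, sub_eq_zero]
    rw [integral_congr_ae hae, integral_indicator_const _ hmS, Complex.real_smul]
    have : (Real.pi : ℂ) ≠ 0 := by exact_mod_cast hpi.ne'
    push_cast
    field_simp
  · refine Integrable.of_bound (C := 1) ?_ (ae_of_all _ fun z => ?_)
    · refine Measurable.aestronglyMeasurable ?_
      unfold Function.uncurry
      fun_prop
    · simp only [Function.uncurry]
      rw [Complex.norm_exp_ofReal_mul_I]

variable {ι : Type*} [Fintype ι] {X : ι → Ω → ℝ} {p : ι → ℝ}

theorem integral_exp_sum_bernoulli (hX : ∀ i, Measurable (X i)) (hind : iIndepFun X μ)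
    (h1 : ∀ i, μ.real {ω | X i ω = 1} = p i) (h0 : ∀ i, μ.real {ω | X i ω = 0} = 1 - p i)
    (c t : ℝ) :
    ∫ ω, Complex.exp ((t * (∑ i, X i ω - c) : ℝ) * Complex.I) ∂μ
      = Complex.exp ((-((c - ∑ i, p i) * t) : ℝ) * Complex.I)
        * ∏ i, centredBernoulliCharFun (p i) t := by
  have e : ∀ ω, Complex.exp ((t * (∑ i, X i ω - c) : ℝ) * Complex.I)
      = Complex.exp ((-((c - ∑ i, p i) * t) : ℝ) * Complex.I)
        * ∏ i, Complex.exp ((t * (X i ω - p i) : ℝ) * Complex.I) := by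
    intro ω
    rw [← Complex.exp_sum, ← Complex.exp_add, ← Finset.sum_mul, ← add_mul, ← Complex.ofReal_sum,
      ← Complex.ofReal_add, ← Finset.mul_sum, Finset.sum_sub_distrib]
    congr 3
    ring
  simp_rw [e]
  rw [integral_const_mul]
  congr 1
  rw [hind.integral_fun_prod_comp (f := fun i x => Complex.exp ((t * (x - p i) : ℝ) * Complex.I))
    (fun i => (hX i).aemeasurable) (fun i => by
      refine Measurable.aestronglyMeasurable ?_
      fun_prop)]
  refine Finset.prod_congr rfl fun i _ => ?_
  rw [integral_comp_of_bernoulli (hX i) (h1 i) (h0 i)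
    (fun x : ℝ => Complex.exp ((t * (x - p i) : ℝ) * Complex.I)), centredBernoulliCharFun,
    Complex.real_smul, Complex.real_smul]
  have : Complex.exp ((t * (1 - p i) : ℝ) * Complex.I)
      = Complex.exp ((-(p i * t) : ℝ) * Complex.I) * Complex.exp (t * Complex.I) := by
    rw [← Complex.exp_add]
    congr 1
    push_cast
    ring
  rw [this, show t * (0 - p i) = -(p i * t) by ring]
  ring

/-- Local limit theorem for sums of independent Bernoulli variables, with a uniform error of the
order of the inverse of the variance. -/
theorem abs_measureReal_sum_bernoulli_sub_le (hX : ∀ i, Measurable (X i)) (hind : iIndepFun X μ)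
    (h1 : ∀ i, μ.real {ω | X i ω = 1} = p i) (h0 : ∀ i, μ.real {ω | X i ω = 0} = 1 - p i)
    {m B : ℝ} (hm : m = ∑ i, p i) (hB : B = ∑ i, p i * (1 - p i)) (hB0 : 0 < B) (κ : ℤ) :
    |μ.real {ω | ∑ i, X i ω = (κ : ℝ)}
        - Real.exp (-((κ : ℝ) - m) ^ 2 / (2 * B)) / Real.sqrt (2 * Real.pi * B)|
      ≤ (Real.exp 5 * Real.pi ^ 3 / 4 + Real.pi / 4) / B := by
  have hpi := Real.pi_pos
  have hpi3 := Real.pi_gt_three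
  have hp0 : ∀ i, 0 ≤ p i := fun i => h1 i ▸ measureReal_nonneg
  have hp1 : ∀ i, p i ≤ 1 := fun i => by
    have : 0 ≤ 1 - p i := h0 i ▸ measureReal_nonneg
    linarith
  have hint : ∀ᵐ ω ∂μ, ∃ k : ℤ, ∑ i, X i ω = k := by
    have : ∀ᵐ ω ∂μ, ∀ i, X i ω = 0 ∨ X i ω = 1 :=
      ae_all_iff.mpr fun i => ae_eq_zero_or_eq_one_of_bernoulli (hX i) (h1 i) (h0 i)
    filter_upwards [this] with ω hω
    have hz : ∀ i, ∃ k : ℤ, X i ω = k := fun i =>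
      (hω i).elim (fun h => ⟨0, by simp [h]⟩) (fun h => ⟨1, by simp [h]⟩)
    choose k hk using hz
    exact ⟨∑ i, k i, by simp [hk]⟩
  set x : ℝ := κ - m with hx
  have hb : 0 < 2 * B / Real.pi ^ 2 := by positivity
  set b : ℝ := 2 * B / Real.pi ^ 2 with hbdef
  set F : ℝ → ℂ := fun t => Complex.exp ((-(x * t) : ℝ) * Complex.I)
    * ∏ i, centredBernoulliCharFun (p i) t with hF
  set G : ℝ → ℂ := fun t => Complex.exp ((-(x * t) : ℝ) * Complex.I)
    * (Real.exp (-(B * t ^ 2 / 2)) : ℝ) with hG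
  have hFc : Continuous F := by
    simp only [hF, centredBernoulliCharFun]
    fun_prop
  have hP : ((μ.real {ω | ∑ i, X i ω = (κ : ℝ)} : ℝ) : ℂ) = (1 / (2 * Real.pi) : ℝ)
      * ∫ t, Set.indicator (Set.Ioc (-Real.pi) Real.pi) F t := by
    rw [measureReal_eq_int_eq_integral_charFun (by fun_prop) hint κ,
      integral_indicator measurableSet_Ioc, intervalIntegral.integral_of_le (by linarith)]
    simp_rw [integral_exp_sum_bernoulli hX hind h1 h0, ← hm]
    rfl
  have hQ := gaussianDensity_eq_integral hB0 x
  have hFi : Integrable (Set.indicator (Set.Ioc (-Real.pi) Real.pi) F) :=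
    (integrable_indicator_iff measurableSet_Ioc).mpr hFc.integrableOn_Ioc
  have hGi : Integrable G := by
    have hg : Integrable (fun t : ℝ => Real.exp (-(B / 2) * t ^ 2)) :=
      integrable_exp_neg_mul_sq (by positivity)
    refine hg.mono' ?_ (ae_of_all _ fun t => ?_)
    · refine Continuous.aestronglyMeasurable ?_
      simp only [hG]
      fun_prop
    · simp only [hG]
      rw [norm_mul, Complex.norm_exp_ofReal_mul_I, one_mul, Complex.norm_real,
        Real.norm_of_nonneg (Real.exp_pos _).le]
      exact le_of_eq (by ring_nf)
  have hbound : ∀ t : ℝ, ‖Set.indicator (Set.Ioc (-Real.pi) Real.pi) F t - G t‖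
      ≤ 2 * Real.exp 5 * B * (|t| ^ 3 * Real.exp (-b * t ^ 2))
        + |t| ^ 1 * Real.exp (-b * t ^ 2) := by
    intro t
    have hpos1 : 0 ≤ 2 * Real.exp 5 * B * (|t| ^ 3 * Real.exp (-b * t ^ 2)) := by positivity
    have hpos2 : 0 ≤ |t| ^ 1 * Real.exp (-b * t ^ 2) := by positivity
    by_cases ht : t ∈ Set.Ioc (-Real.pi) Real.pi
    · rw [Set.indicator_of_mem ht]
      simp only [hF, hG]
      rw [← mul_sub, norm_mul, Complex.norm_exp_ofReal_mul_I, one_mul]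
      have h := norm_prod_centredBernoulliCharFun_sub_exp_le Finset.univ p (fun i _ => hp0 i)
        (fun i _ => hp1 i) (abs_le.mpr ⟨ht.1.le, ht.2⟩)
      rw [← hB] at h
      have e : -(2 / Real.pi ^ 2 * t ^ 2) * B = -b * t ^ 2 := by rw [hbdef]; ring
      rw [e] at h
      linarith
    · rw [Set.indicator_of_notMem ht, zero_sub, norm_neg]
      simp only [hG]
      rw [norm_mul, Complex.norm_exp_ofReal_mul_I, one_mul, Complex.norm_real,
        Real.norm_of_nonneg (Real.exp_pos _).le]
      -- Inserting the factor $|t|\ge1$ in the tail gives the integral $1/b$, of order $1/B$; the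
      -- plain Gaussian integral would give only $B^{-1/2}$.
      have ht1 : 1 ≤ |t| := by
        by_contra! hlt
        have := abs_lt.mp hlt
        exact ht ⟨by linarith, by linarith⟩
      have hb2 : b ≤ B / 2 := by
        rw [hbdef, div_le_iff₀ (by positivity)]
        nlinarith [mul_le_mul_of_nonneg_left (by nlinarith : (4 : ℝ) ≤ Real.pi ^ 2) hB0.le]
      have he : Real.exp (-(B * t ^ 2 / 2)) ≤ Real.exp (-b * t ^ 2) := by
        rw [Real.exp_le_exp]
        nlinarith [mul_le_mul_of_nonneg_right hb2 (sq_nonneg t)]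
      have := mul_le_mul_of_nonneg_right ht1 (Real.exp_pos (-b * t ^ 2)).le
      rw [pow_one]
      linarith
  have hi3 := (integrable_abs_pow_mul_exp_neg_mul_sq hb 3).const_mul (2 * Real.exp 5 * B)
  have hi1 := integrable_abs_pow_mul_exp_neg_mul_sq hb 1
  have hI := norm_integral_le_of_norm_le (hi3.add hi1) (ae_of_all _ hbound)
  simp only [Pi.add_apply] at hI
  rw [integral_add hi3 hi1, integral_const_mul, integral_abs_mul_exp_neg_mul_sq hb,
    integral_abs_cube_mul_exp_neg_mul_sq hb, integral_sub hFi hGi] at hI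
  rw [← Real.norm_eq_abs, ← Complex.norm_real, Complex.ofReal_sub, hP, hQ, ← mul_sub, norm_mul,
    Complex.norm_real, Real.norm_of_nonneg (by positivity)]
  -- The constant is $\frac1{2\pi}\bigl(2e^5B/b^2+1/b\bigr)$ with $b=2B/\pi^2$.
  refine (mul_le_mul_of_nonneg_left hI (by positivity)).trans (le_of_eq ?_)
  rw [hbdef]
  field_simp
  ring

end Bernoulli

/-! ### Mean and variance in the Cramér model, and the conclusion. -/

section Cramer

theorem one_lt_log_of_three_le {i : ℕ} (hi : 3 ≤ i) : 1 < Real.log i := by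
  rw [Real.lt_log_iff_exp_lt (by positivity)]
  have : (3 : ℝ) ≤ i := by exact_mod_cast hi
  linarith [Real.exp_one_lt_three]

variable {Ω : Type*} [MeasurableSpace Ω] {μ : Measure Ω} {ξ : ℕ → Ω → ℝ}

theorem IsCramerModel.cramerMean_eq [IsProbabilityMeasure μ] (h : IsCramerModel μ ξ) (n : ℕ) :
    cramerMean μ ξ n = ∑ j ∈ Finset.Icc 3 n, 1 / Real.log j := by
  simp only [cramerMean, cramerSum]
  rw [integral_finsetSum]
  · refine Finset.sum_congr rfl fun j hj => ?_
    have hj := (Finset.mem_Icc.mp hj).1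
    exact integral_of_bernoulli (h.measurable j hj) (h.prob_one j hj) (h.prob_zero j hj)
  · intro j hj
    have hj := (Finset.mem_Icc.mp hj).1
    exact (memLp_of_bernoulli (h.measurable j hj) (h.prob_one j hj)
      (h.prob_zero j hj) 1).integrable le_rfl

theorem IsCramerModel.cramerVar_eq [IsProbabilityMeasure μ] (h : IsCramerModel μ ξ) (n : ℕ) :
    cramerVar μ ξ n = ∑ j ∈ Finset.Icc 3 n, 1 / Real.log j * (1 - 1 / Real.log j) := by
  have e : cramerSum ξ n = ∑ j ∈ Finset.Icc 3 n, ξ j := by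
    ext ω
    simp [cramerSum]
  rw [cramerVar, e, IndepFun.variance_sum]
  · refine Finset.sum_congr rfl fun j hj => ?_
    have hj := (Finset.mem_Icc.mp hj).1
    exact variance_of_bernoulli (h.measurable j hj) (h.prob_one j hj) (h.prob_zero j hj)
  · intro j hj
    have hj := (Finset.mem_Icc.mp hj).1
    exact memLp_of_bernoulli (h.measurable j hj) (h.prob_one j hj) (h.prob_zero j hj) 2
  · intro i hi j hj hij
    have hi := (Finset.mem_Icc.mp hi).1
    have hj := (Finset.mem_Icc.mp hj).1
    exact h.indep.indepFun (i := ⟨i, hi⟩) (j := ⟨j, hj⟩) (by simpa using hij)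

theorem le_sum_inv_log_mul_one_sub {n : ℕ} (hn : 3 ≤ n) :
    (1 - 1 / Real.log 3) / 3 * (n / Real.log n)
      ≤ ∑ j ∈ Finset.Icc 3 n, 1 / Real.log j * (1 - 1 / Real.log j) := by
  have h3 : 1 < Real.log 3 := by exact_mod_cast one_lt_log_of_three_le le_rfl
  have hδ : 0 < 1 - 1 / Real.log 3 := by
    rw [sub_pos, div_lt_one (by linarith)]
    exact h3
  have hln := one_lt_log_of_three_le hn
  have hterm : ∀ j ∈ Finset.Icc 3 n, 1 / Real.log n * (1 - 1 / Real.log 3)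
      ≤ 1 / Real.log j * (1 - 1 / Real.log j) := by
    intro j hj
    obtain ⟨hj3, hjn⟩ := Finset.mem_Icc.mp hj
    have hlj := one_lt_log_of_three_le hj3
    have hj3' : (3 : ℝ) ≤ j := by exact_mod_cast hj3
    have hjn' : (j : ℝ) ≤ n := by exact_mod_cast hjn
    have hl1 : Real.log 3 ≤ Real.log j := Real.log_le_log (by norm_num) hj3'
    have hl2 : Real.log j ≤ Real.log n := Real.log_le_log (by linarith) hjn'
    have a1 : 1 / Real.log n ≤ 1 / Real.log j := one_div_le_one_div_of_le (by linarith) hl2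
    have a2 : 1 / Real.log j ≤ 1 / Real.log 3 := one_div_le_one_div_of_le (by linarith) hl1
    exact mul_le_mul a1 (by linarith) hδ.le (by positivity)
  have h := Finset.card_nsmul_le_sum _ _ _ hterm
  rw [nsmul_eq_mul, Nat.card_Icc, Nat.cast_sub (by omega)] at h
  refine le_trans ?_ h
  have hn' : (3 : ℝ) ≤ n := by exact_mod_cast hn
  -- There are $n-2$ terms, and $n-2\ge n/3$ holds from $n=3$ on, with equality there.
  have : (n : ℝ) / 3 ≤ (n + 1 : ℕ) - (3 : ℕ) := by push_cast; linarith
  calc (1 - 1 / Real.log 3) / 3 * (n / Real.log n)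
      = n / 3 * (1 / Real.log n * (1 - 1 / Real.log 3)) := by ring
    _ ≤ _ := mul_le_mul_of_nonneg_right this (by positivity)

end Cramer

theorem mainTheorem9 :
    ∃ C₀ : ℝ, 0 < C₀ ∧
      ∀ C : ℝ, C₀ ≤ C →
        ∀ {Ω : Type*} [MeasurableSpace Ω] (μ : Measure Ω) [IsProbabilityMeasure μ]
          (ξ : ℕ → Ω → ℝ), IsCramerModel μ ξ →
        ∀ n : ℕ, 3 ≤ n → ∀ κ : ℤ,
          |(κ : ℝ) - cramerMean μ ξ n| ≤ C * ((n : ℝ) ^ (3 / 4 : ℝ) / Real.log n) →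
          |μ.real {ω | cramerSum ξ n ω = (κ : ℝ)}
              - Real.exp (-((κ : ℝ) - cramerMean μ ξ n) ^ 2 / (2 * cramerVar μ ξ n))
                / Real.sqrt (2 * Real.pi * cramerVar μ ξ n)|
            ≤ C * (Real.log n ^ (3 / 2 : ℝ) / n) := by
  have hpi := Real.pi_pos
  have h3 : 1 < Real.log 3 := by exact_mod_cast one_lt_log_of_three_le le_rfl
  have hδ : 0 < (1 - 1 / Real.log 3) / 3 := by
    refine div_pos ?_ three_pos
    rw [sub_pos, div_lt_one (by linarith)]
    exact h3
  set δ := (1 - 1 / Real.log 3) / 3 with hδdef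
  have hK : 0 < Real.exp 5 * Real.pi ^ 3 / 4 + Real.pi / 4 := by positivity
  set K := Real.exp 5 * Real.pi ^ 3 / 4 + Real.pi / 4 with hKdef
  refine ⟨K / δ, by positivity, ?_⟩
  intro C hC Ω _ μ _ ξ hξ n hn κ _
  have hn0 : (0 : ℝ) < n := by exact_mod_cast (by omega : 0 < n)
  have hln := one_lt_log_of_three_le hn
  have hB : δ * (n / Real.log n) ≤ cramerVar μ ξ n := by
    rw [hξ.cramerVar_eq]
    exact le_sum_inv_log_mul_one_sub hn
  have hB' : 0 < δ * (n / Real.log n) := by positivity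
  have hj : ∀ i : Finset.Icc 3 n, 3 ≤ (i : ℕ) := fun i => (Finset.mem_Icc.mp i.2).1
  have hsum : ∀ f : ℕ → ℝ, ∑ i : Finset.Icc 3 n, f i = ∑ j ∈ Finset.Icc 3 n, f j :=
    fun f => Finset.sum_coe_sort _ f
  have hind : iIndepFun (fun i : Finset.Icc 3 n => ξ i) μ :=
    hξ.indep.precomp (g := fun i : Finset.Icc 3 n => (⟨i, hj i⟩ : {i : ℕ // 3 ≤ i}))
      (fun a b hab => Subtype.ext (by simpa using hab))
  have hmain := abs_measureReal_sum_bernoulli_sub_le (p := fun i : Finset.Icc 3 n => 1 / Real.log i)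
    (fun i => hξ.measurable i (hj i)) hind (fun i => hξ.prob_one i (hj i))
    (fun i => hξ.prob_zero i (hj i)) (m := cramerMean μ ξ n) (B := cramerVar μ ξ n)
    (by rw [hξ.cramerMean_eq, hsum fun j => 1 / Real.log j])
    (by rw [hξ.cramerVar_eq, hsum fun j => 1 / Real.log j * (1 - 1 / Real.log j)])
    (hB'.trans_le hB) κ
  have hset : {ω | ∑ i : Finset.Icc 3 n, ξ i ω = (κ : ℝ)} = {ω | cramerSum ξ n ω = (κ : ℝ)} := by
    ext ω
    simp only [Set.mem_ofPred_eq, cramerSum, hsum fun j => ξ j ω]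
  rw [hset] at hmain
  refine hmain.trans ?_
  -- Since $\log n>1$, the bound of order $\log n/n$ is within the claimed one.
  have hlog : Real.log n ≤ Real.log n ^ (3 / 2 : ℝ) :=
    Real.self_le_rpow_of_one_le hln.le (by norm_num)
  calc K / cramerVar μ ξ n ≤ K / (δ * (n / Real.log n)) := by gcongr
    _ = K / δ * (Real.log n / n) := by field_simp
    _ ≤ K / δ * (Real.log n ^ (3 / 2 : ℝ) / n) := by gcongr
    _ ≤ C * (Real.log n ^ (3 / 2 : ℝ) / n) := by gcongr
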